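/- Let $(a)_k = a(a+1)\cdots(a+k-1)$ and $${}_6F_5\left(\begin{matrix} a_1,\dots,a_6\\ b_1,\dots,b_5\end{matrix}\,\middle|\, x\right)=\sum_{k=0}^\infty \frac{(a_1)_k\cdots(a_6)_k}{(b_1)_k\cdots(b_5)_k}\frac{x^k}{k!}.$$ The following two statements are equivalent. (A) For every complex number $z$ such that $z^4\ne k^4$ for all integers $k\ge 1$, both series below converge absolutely and $$\sum_{k=1}^\infty \frac{1}{k^3(1-z^4/k^4)} = \frac52\sum_{k=1}^\infty \frac{(-1)^{k+1}}{k^3\binom{2k}{k}}\,\frac{1}{1-z^4/k^4}\prod_{j=1}^{k-1}\frac{1+4z^4/j^4}{1-z^4/j^4}.$$ (B) For every positive integer $n$, the series on the left below converges absolutely and $${}_6F_5\left(\begin{matrix} n+1,\ n+1,\ 2n+in,\ 2n-in,\ in,\ -in\\ n+\tfrac12,\ n,\ 2n+1,\ n+1+in,\ n+1-in\end{matrix}\,\middle|\,-\frac14\right) = \frac25\binom{2n}{n}\prod_{j=1}^{n-1}\frac{n^4-j^4}{4n^4+j^4}.$$ -/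

import Mathlib

/-- The Pochhammer symbol (rising factorial) `(a)_k = a (a + 1) ⋯ (a + k - 1)`. -/
noncomputable def pochhammerSymbol (a : ℂ) (k : ℕ) : ℂ :=
  ∏ i ∈ Finset.range k, (a + (i : ℂ))

/-- The `k`-th term of the generalized hypergeometric series `pFq(a; b | x)`, with numerator
parameters `a` and denominator parameters `b`. -/
noncomputable def pFqTerm {p q : ℕ} (a : Fin p → ℂ) (b : Fin q → ℂ) (x : ℂ) (k : ℕ) : ℂ :=
  (∏ i, pochhammerSymbol (a i) k) / (∏ i, pochhammerSymbol (b i) k) *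
    (x ^ k / (k.factorial : ℂ))

/-- The generalized hypergeometric series `pFq(a; b | x)`. -/
noncomputable def pFq {p q : ℕ} (a : Fin p → ℂ) (b : Fin q → ℂ) (x : ℂ) : ℂ :=
  ∑' k : ℕ, pFqTerm a b x k

/-- The numerator parameters `n + 1, n + 1, 2n + in, 2n - in, in, -in`. -/
noncomputable def upperParams (n : ℕ) : Fin 6 → ℂ :=
  ![(n : ℂ) + 1, (n : ℂ) + 1, 2 * (n : ℂ) + Complex.I * n, 2 * (n : ℂ) - Complex.I * n,
    Complex.I * n, -(Complex.I * n)]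

/-- The denominator parameters `n + 1/2, n, 2n + 1, n + 1 + in, n + 1 - in`. -/
noncomputable def lowerParams (n : ℕ) : Fin 5 → ℂ :=
  ![(n : ℂ) + 1 / 2, (n : ℂ), 2 * (n : ℂ) + 1, (n : ℂ) + 1 + Complex.I * n,
    (n : ℂ) + 1 - Complex.I * n]

/-- The `k`-th term (`k ≥ 1`) of `∑ 1 / (k³ (1 - z⁴/k⁴))`. -/
noncomputable def zetaTerm (z : ℂ) (k : ℕ) : ℂ :=
  1 / ((k : ℂ) ^ 3 * (1 - z ^ 4 / (k : ℂ) ^ 4))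

/-- The `k`-th term (`k ≥ 1`) of the Apéry-like series
`∑ (-1)^(k+1) / (k³ (2k choose k)) · 1 / (1 - z⁴/k⁴) · ∏_{1 ≤ j < k} (1 + 4z⁴/j⁴) / (1 - z⁴/j⁴)`. -/
noncomputable def aperyTerm (z : ℂ) (k : ℕ) : ℂ :=
  (-1) ^ (k + 1) / ((k : ℂ) ^ 3 * ((2 * k).choose k : ℂ)) *
    (1 / (1 - z ^ 4 / (k : ℂ) ^ 4)) *
    ∏ j ∈ Finset.Ico 1 k, (1 + 4 * z ^ 4 / (j : ℂ) ^ 4) / (1 - z ^ 4 / (j : ℂ) ^ 4)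

/-- The conjectured generating function identity: for every complex `z` at which no denominator
vanishes, both series (over `k ≥ 1`) converge, and the first is `5/2` times the second. -/
def TheoremA : Prop :=
  ∀ z : ℂ, (∀ k : ℕ, 1 ≤ k → z ^ 4 ≠ (k : ℂ) ^ 4) →
    Summable (fun k : ℕ => zetaTerm z (k + 1)) ∧
    Summable (fun k : ℕ => aperyTerm z (k + 1)) ∧
    ∑' k : ℕ, zetaTerm z (k + 1) = 5 / 2 * ∑' k : ℕ, aperyTerm z (k + 1)

/-! Both statements are proved outright, so the equivalence is `iff_of_true`; one WZ pair serves
both. With `w = z ^ 4`, `wz_relation` gives F(n,k) - F(n+1,k) = G(n,k) - G(n,k+1). Summing over `k`,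
where G tends to 0, makes G(n,0) the difference of consecutive sums S(n) = ∑ F(n,k). Since S(n)
tends to 0, S(0) = ∑ G(n,0) (`hasSum_wzG`). The argument uses only two homogeneous recurrences for
the kernel and its decay at `n = 0`, so the kernel can vary. The reciprocal product `zetaKernel`
turns S(0) = ∑ G(n,0) into (A). Its residue at the pole `w = (M + 1) ^ 4` obeys the same
recurrences: S(0) then has a single nonzero term, while G(n,0) vanishes for `n < M` and from `n = M`
on is a constant times the 6F5 series with parameter `M + 1`. This is (B). -/

open Filter Topology Asymptotics

/-! ### The WZ pair and its summation, for an arbitrary kernel -/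

/-- The factor of the WZ pair that depends on the acceleration index `n` only. -/
noncomputable def wzCoeff (w : ℂ) (n : ℕ) : ℂ :=
  (-1) ^ n / (n.centralBinom : ℂ) * ∏ m ∈ Finset.range n, (((m : ℂ) + 1) ^ 4 + 4 * w)

/-- A kernel `P n k` that behaves like `1 / ∏_{k < j ≤ n + k + 1} (j ^ 4 - w)`. -/
structure IsWZKernel (w : ℂ) (P : ℕ → ℕ → ℂ) : Prop where
  step_left : ∀ n k : ℕ, P n k = (((n : ℂ) + k + 2) ^ 4 - w) * P (n + 1) k
  step_right : ∀ n k : ℕ, P n (k + 1) = (((k : ℂ) + 1) ^ 4 - w) * P (n + 1) k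
  isBigO_zero : P 0 =O[atTop] fun k : ℕ => 1 / ((k : ℝ) + 1) ^ 4

/-- The summand of the WZ pair that is summed over `k`. -/
noncomputable def wzF (w : ℂ) (P : ℕ → ℕ → ℂ) (n k : ℕ) : ℂ :=
  wzCoeff w n * (((n : ℂ) + 2 * (k + 1)) / 2) * P n k

/-- The certificate of the WZ pair, summed over `n` at `k = 0`. -/
noncomputable def wzG (w : ℂ) (P : ℕ → ℕ → ℂ) (n k : ℕ) : ℂ :=
  wzCoeff w n * ((((k : ℂ) + 1) ^ 2 + (3 * n + 1) * (k + 1) + (5 * (n : ℂ) ^ 2 + 4 * n + 1) / 2) /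
    (2 * (2 * n + 1))) * P n k

theorem two_mul_natCast_add_one_ne_zero (n : ℕ) : (2 * (n : ℂ) + 1) ≠ 0 := by
  exact_mod_cast Nat.succ_ne_zero (2 * n)

theorem centralBinom_cast_ne_zero (n : ℕ) : (n.centralBinom : ℂ) ≠ 0 := by
  exact_mod_cast n.centralBinom_ne_zero

theorem centralBinom_succ_cast (n : ℕ) :
    ((n + 1).centralBinom : ℂ) = 2 * (2 * n + 1) / (n + 1) * n.centralBinom := by
  have h : ((n : ℂ) + 1) * (n + 1).centralBinom = 2 * (2 * n + 1) * n.centralBinom := by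
    exact_mod_cast Nat.succ_mul_centralBinom_succ n
  have h1 : (n : ℂ) + 1 ≠ 0 := Nat.cast_add_one_ne_zero n
  field_simp
  linear_combination h

theorem wzCoeff_succ (w : ℂ) (n : ℕ) :
    wzCoeff w (n + 1) =
      -(((n : ℂ) + 1) / (2 * (2 * n + 1))) * (((n : ℂ) + 1) ^ 4 + 4 * w) * wzCoeff w n := by
  have h1 : (n : ℂ) + 1 ≠ 0 := Nat.cast_add_one_ne_zero n
  have h2 := two_mul_natCast_add_one_ne_zero n
  have h3 := centralBinom_cast_ne_zero n
  unfold wzCoeff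
  rw [Finset.prod_range_succ, centralBinom_succ_cast, pow_succ]
  field_simp

theorem natCast_add_pow_sub_tendsto (w : ℂ) (c : ℕ) :
    Tendsto (fun k : ℕ => ‖(((k + c : ℕ) : ℂ)) ^ 4 - w‖) atTop atTop := by
  have h : Tendsto (fun k : ℕ => ((k + c : ℕ) : ℝ) ^ 4 - ‖w‖) atTop atTop := by
    apply tendsto_atTop_add_const_right
    exact (tendsto_pow_atTop (by norm_num)).comp
      (tendsto_natCast_atTop_atTop.comp (tendsto_add_atTop_nat c))
  refine tendsto_atTop_mono (fun k => ?_) h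
  have := norm_sub_norm_le ((((k + c : ℕ) : ℂ)) ^ 4) w
  rwa [norm_pow, Complex.norm_natCast] at this

namespace IsWZKernel

variable {w : ℂ} {P : ℕ → ℕ → ℂ}

theorem wz_relation (hP : IsWZKernel w P) (n k : ℕ) :
    wzF w P n k - wzF w P (n + 1) k = wzG w P n k - wzG w P n (k + 1) := by
  have h2 := two_mul_natCast_add_one_ne_zero n
  unfold wzF wzG
  rw [hP.step_right n k, hP.step_left n k, wzCoeff_succ]
  -- Both recurrences express everything through `P (n + 1) k`; its coefficient is a polynomial
  -- identity over `2 * n + 1`, so no factor `j ^ 4 - w` has to be nonzero.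
  have key : ((n : ℂ) + 2 * (k + 1)) / 2 * (((n : ℂ) + k + 2) ^ 4 - w) +
      ((n : ℂ) + 1) / (2 * (2 * n + 1)) * (((n : ℂ) + 1) ^ 4 + 4 * w) *
        ((n + 1 + 2 * (k + 1)) / 2) =
      (((k : ℂ) + 1) ^ 2 + (3 * n + 1) * (k + 1) + (5 * (n : ℂ) ^ 2 + 4 * n + 1) / 2) /
        (2 * (2 * n + 1)) * (((n : ℂ) + k + 2) ^ 4 - w) -
      (((k : ℂ) + 1 + 1) ^ 2 + (3 * n + 1) * (k + 1 + 1) + (5 * (n : ℂ) ^ 2 + 4 * n + 1) / 2) /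
        (2 * (2 * n + 1)) * (((k : ℂ) + 1) ^ 4 - w) := by
    simp only [div_eq_mul_inv, mul_inv]
    linear_combination
      -(((n : ℂ) + 2 * (k + 1)) / 2 * (((n : ℂ) + k + 2) ^ 4 - w)) * inv_mul_cancel₀ h2
  push_cast
  linear_combination wzCoeff w n * P (n + 1) k * key

theorem isBigO (hP : IsWZKernel w P) (n : ℕ) :
    P n =O[atTop] fun k : ℕ => 1 / ((k : ℝ) + 1) ^ 4 := by
  induction n with
  | zero => exact hP.isBigO_zero
  | succ n ih =>
    refine IsBigO.trans (IsBigO.of_bound 1 ?_) ih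
    filter_upwards [(natCast_add_pow_sub_tendsto w (n + 2)).eventually_ge_atTop 1] with k hk
    have h := hP.step_left n k
    have e : (((n : ℂ) + k + 2) ^ 4 - w) = ((k + (n + 2) : ℕ) : ℂ) ^ 4 - w := by
      push_cast; ring
    rw [one_mul, h, e, norm_mul]
    exact le_mul_of_one_le_left (norm_nonneg _) hk

theorem summable_wzF (hP : IsWZKernel w P) (n : ℕ) : Summable (wzF w P n) := by
  have hs : Summable fun k : ℕ => 1 / ((k : ℝ) + 1) ^ 3 := by
    have := (summable_nat_add_iff 1).2 (Real.summable_one_div_nat_pow.2 (by norm_num : 1 < 3))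
    simpa using this
  have hlin : (fun k : ℕ => wzCoeff w n * (((n : ℂ) + 2 * (k + 1)) / 2)) =O[atTop]
      fun k : ℕ => (k : ℝ) + 1 := by
    refine IsBigO.const_mul_left (IsBigO.of_bound (n + 1) (Eventually.of_forall fun k => ?_)) _
    have e : (((n : ℂ) + 2 * (k + 1)) / 2) = (((n + 2 * (k + 1) : ℕ) : ℝ) / 2 : ℝ) := by
      push_cast; ring
    rw [e, Complex.norm_real, Real.norm_of_nonneg (by positivity),
      Real.norm_of_nonneg (by positivity)]
    push_cast
    have : (0 : ℝ) ≤ n * k := by positivity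
    nlinarith
  refine summable_of_isBigO_nat hs ((hlin.mul (hP.isBigO n)).congr_right fun k => ?_)
  have : (k : ℝ) + 1 ≠ 0 := by positivity
  field_simp

theorem tendsto_wzG (hP : IsWZKernel w P) (n : ℕ) : Tendsto (wzG w P n) atTop (𝓝 0) := by
  have hq : (fun k : ℕ => wzCoeff w n * ((((k : ℂ) + 1) ^ 2 + (3 * n + 1) * (k + 1) +
      (5 * (n : ℂ) ^ 2 + 4 * n + 1) / 2) / (2 * (2 * n + 1)))) =O[atTop]
      fun k : ℕ => ((k : ℝ) + 1) ^ 2 := by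
    refine IsBigO.const_mul_left ?_ _
    simp_rw [div_eq_mul_inv _ (2 * (2 * (n : ℂ) + 1)), mul_comm _ (2 * (2 * (n : ℂ) + 1))⁻¹]
    refine IsBigO.const_mul_left (IsBigO.of_bound (1 + (3 * n + 1) + (5 * n ^ 2 + 4 * n + 1) / 2)
      (Eventually.of_forall fun k => ?_)) _
    have e : (((k : ℂ) + 1) ^ 2 + (3 * n + 1) * (k + 1) + (5 * (n : ℂ) ^ 2 + 4 * n + 1) / 2) =
        ((((k : ℝ) + 1) ^ 2 + (3 * n + 1) * (k + 1) + (5 * (n : ℝ) ^ 2 + 4 * n + 1) / 2 : ℝ) : ℂ) := by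
      push_cast; ring
    rw [e, Complex.norm_real, Real.norm_of_nonneg (by positivity),
      Real.norm_of_nonneg (by positivity),
      add_mul _ _ (((k : ℝ) + 1) ^ 2), add_mul _ _ (((k : ℝ) + 1) ^ 2), one_mul]
    have h1 : (1 : ℝ) ≤ (k : ℝ) + 1 := by linarith [(Nat.cast_nonneg k : (0 : ℝ) ≤ k)]
    refine add_le_add (add_le_add le_rfl ?_) ?_
    · gcongr
      exact le_self_pow₀ h1 (by norm_num)
    · exact le_mul_of_one_le_right (by positivity) (one_le_pow₀ h1)
  refine ((hq.mul (hP.isBigO n)).congr_right (g₂ := fun k : ℕ => (1 / ((k : ℝ) + 1)) ^ 2)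
    fun k => ?_).trans_tendsto ?_
  · have : (k : ℝ) + 1 ≠ 0 := by positivity
    field_simp
  · simpa only [zero_pow two_ne_zero] using
      (tendsto_one_div_add_atTop_nhds_zero_nat (𝕜 := ℝ)).pow 2

theorem tsum_wzF_sub (hP : IsWZKernel w P) (n : ℕ) :
    ∑' k, wzF w P n k - ∑' k, wzF w P (n + 1) k = wzG w P n 0 := by
  have h := ((hP.summable_wzF n).sub (hP.summable_wzF (n + 1))).hasSum
  rw [(hP.summable_wzF n).tsum_sub (hP.summable_wzF (n + 1))] at h
  refine tendsto_nhds_unique h.tendsto_sum_nat ?_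
  simp_rw [hP.wz_relation, Finset.sum_range_sub']
  simpa using (hP.tendsto_wzG n).const_sub (wzG w P n 0)

/-- The ratio is at most 1/3 · 5/4 · 6/5 = 1/2: the central binomial gives 1/3, the quartic quotient
5/4 (this needs `21 * ‖w‖ ≤ (n + 1) ^ 4`), and the linear factor 6/5 (this needs `3 ≤ n`). The bound
is uniform in `k`. -/
theorem norm_wzF_succ_le (hP : IsWZKernel w P) {n : ℕ} (hn : 21 * ‖w‖ + 3 ≤ n) (k : ℕ) :
    ‖wzF w P (n + 1) k‖ ≤ 1 / 2 * ‖wzF w P n k‖ := by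
  have hw := norm_nonneg w
  have hk : (0 : ℝ) ≤ k := Nat.cast_nonneg k
  have hn3 : (3 : ℝ) ≤ n := by linarith
  have hD : ((n : ℝ) + 1) ^ 4 - ‖w‖ ≤ ‖((n : ℂ) + k + 2) ^ 4 - w‖ := by
    have h := norm_sub_norm_le (((n : ℂ) + k + 2) ^ 4) w
    have e : ((n : ℂ) + k + 2) = ((n + k + 2 : ℕ) : ℂ) := by push_cast; ring
    rw [norm_pow, e, Complex.norm_natCast, ← e] at h
    refine le_trans ?_ h
    push_cast
    refine sub_le_sub_right (pow_le_pow_left₀ (by positivity) ?_ 4) _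
    linarith
  have hN : ‖((n : ℂ) + 1) ^ 4 + 4 * w‖ ≤ ((n : ℝ) + 1) ^ 4 + 4 * ‖w‖ := by
    refine (norm_add_le _ _).trans (le_of_eq ?_)
    have e : ((n : ℂ) + 1) = ((n + 1 : ℕ) : ℂ) := by push_cast; ring
    rw [norm_pow, e, Complex.norm_natCast, norm_mul]
    norm_num
  have hpow : 21 * ‖w‖ ≤ ((n : ℝ) + 1) ^ 4 :=
    le_trans (by linarith) (le_self_pow₀ (by linarith : (1 : ℝ) ≤ n + 1) (by norm_num : 4 ≠ 0))
  have e1 : ‖(-(((n : ℂ) + 1) / (2 * (2 * n + 1))))‖ = ((n : ℝ) + 1) / (2 * (2 * n + 1)) := by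
    have : (-(((n : ℂ) + 1) / (2 * (2 * n + 1)))) =
        ((-(((n : ℝ) + 1) / (2 * (2 * n + 1))) : ℝ) : ℂ) := by push_cast; ring
    rw [this, Complex.norm_real, norm_neg, Real.norm_of_nonneg (by positivity)]
  have e2 : ∀ m : ℕ, ‖((m : ℂ) + 2 * (k + 1)) / 2‖ = ((m : ℝ) + 2 * (k + 1)) / 2 := fun m => by
    have : ((m : ℂ) + 2 * (k + 1)) / 2 = ((((m : ℝ) + 2 * (k + 1)) / 2 : ℝ) : ℂ) := by
      push_cast; ring
    rw [this, Complex.norm_real, Real.norm_of_nonneg (by positivity)]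
  have h1 : ((n : ℝ) + 1) / (2 * (2 * n + 1)) ≤ 1 / 3 := by
    rw [div_le_div_iff₀ (by positivity) (by norm_num)]
    linarith
  have h2 : (((n + 1 : ℕ) : ℝ) + 2 * (k + 1)) / 2 ≤ 6 / 5 * (((n : ℝ) + 2 * (k + 1)) / 2) := by
    push_cast
    linarith
  unfold wzF
  rw [wzCoeff_succ, hP.step_left n k]
  simp only [norm_mul, e1, e2]
  calc ((n : ℝ) + 1) / (2 * (2 * n + 1)) * ‖((n : ℂ) + 1) ^ 4 + 4 * w‖ * ‖wzCoeff w n‖ *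
        ((((n + 1 : ℕ) : ℝ) + 2 * (k + 1)) / 2) * ‖P (n + 1) k‖
      ≤ 1 / 3 * (5 / 4 * ‖((n : ℂ) + k + 2) ^ 4 - w‖) * ‖wzCoeff w n‖ *
        (6 / 5 * (((n : ℝ) + 2 * (k + 1)) / 2)) * ‖P (n + 1) k‖ := by
        gcongr
        linarith
    _ = _ := by ring

theorem norm_wzF_le (hP : IsWZKernel w P) {n₀ : ℕ} (hn : 21 * ‖w‖ + 3 ≤ n₀) (i k : ℕ) :
    ‖wzF w P (n₀ + i) k‖ ≤ (1 / 2) ^ i * ‖wzF w P n₀ k‖ := by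
  induction i with
  | zero => simp
  | succ i ih =>
    have h := hP.norm_wzF_succ_le (n := n₀ + i) (by push_cast; linarith [i.cast_nonneg (α := ℝ)]) k
    rw [pow_succ', mul_assoc]
    exact h.trans (by gcongr)

theorem summable_wzG (hP : IsWZKernel w P) : Summable fun n => wzG w P n 0 := by
  obtain ⟨n₀, hn⟩ := exists_nat_ge (21 * ‖w‖ + 3)
  rw [← summable_nat_add_iff n₀]
  refine Summable.of_norm_bounded (g := fun i => 5 / 2 * ((1 / 2) ^ i * ‖wzF w P n₀ 0‖))
    (((summable_geometric_of_lt_one (by norm_num) (by norm_num)).mul_right _).mul_left _)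
    fun i => ?_
  rw [add_comm i]
  refine le_trans ?_ (mul_le_mul_of_nonneg_left (hP.norm_wzF_le hn i 0) (by norm_num))
  generalize n₀ + i = n
  have h2 := two_mul_natCast_add_one_ne_zero n
  have h3 : (n : ℂ) + 2 ≠ 0 := by exact_mod_cast Nat.succ_ne_zero (n + 1)
  -- At `k = 0` the quadratic in the certificate collapses to 5/2 · (n + 1)², the source of the 5/2
  -- in (A).
  have e : wzG w P n 0 =
      ((5 / 2 * (((n : ℝ) + 1) ^ 2 / ((2 * n + 1) * (n + 2))) : ℝ) : ℂ) * wzF w P n 0 := by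
    unfold wzG wzF
    push_cast
    field_simp
    ring
  rw [e, norm_mul, Complex.norm_real, Real.norm_of_nonneg (by positivity)]
  gcongr
  refine mul_le_of_le_one_right (by norm_num) ?_
  rw [div_le_one (by positivity)]
  nlinarith [(Nat.cast_nonneg n : (0 : ℝ) ≤ n)]

theorem hasSum_wzG (hP : IsWZKernel w P) :
    HasSum (fun n => wzG w P n 0) (∑' k, wzF w P 0 k) := by
  obtain ⟨n₀, hn⟩ := exists_nat_ge (21 * ‖w‖ + 3)
  have hlim : Tendsto (fun i => ∑' k, wzF w P (n₀ + i) k) atTop (𝓝 (∑' _ : ℕ, (0 : ℂ))) := by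
    -- The geometric decay in `n` makes the row `n₀` a summable majorant for all later rows.
    refine tendsto_tsum_of_dominated_convergence (hP.summable_wzF n₀).norm (fun k => ?_)
      (Eventually.of_forall fun i k => (hP.norm_wzF_le hn i k).trans ?_)
    · refine squeeze_zero_norm (hP.norm_wzF_le hn · k) ?_
      simpa using (tendsto_pow_atTop_nhds_zero_of_lt_one (r := (1 / 2 : ℝ)) (by norm_num)
        (by norm_num)).mul_const ‖wzF w P n₀ k‖
    · exact mul_le_of_le_one_left (norm_nonneg _) (pow_le_one₀ (by norm_num) (by norm_num))
  rw [tsum_zero] at hlim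
  simp_rw [add_comm n₀] at hlim
  rw [tendsto_add_atTop_iff_nat (f := fun n => ∑' k, wzF w P n k) n₀] at hlim
  refine (hP.summable_wzG.hasSum_iff_tendsto_nat).2 ?_
  simp_rw [← hP.tsum_wzF_sub, Finset.sum_range_sub' (fun n => ∑' k, wzF w P n k)]
  simpa using hlim.const_sub (∑' k, wzF w P 0 k)

end IsWZKernel

/-! ### Statement (A), from the reciprocal product kernel -/

/-- The kernel `1 / ∏_{k < j ≤ n + k + 1} (j ^ 4 - w)`. -/
noncomputable def zetaKernel (w : ℂ) (n k : ℕ) : ℂ :=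
  (∏ j ∈ Finset.range (n + 1), (((k : ℂ) + 1 + j) ^ 4 - w))⁻¹

theorem isWZKernel_zetaKernel {w : ℂ} (hw : ∀ k : ℕ, ((k : ℂ) + 1) ^ 4 - w ≠ 0) :
    IsWZKernel w (zetaKernel w) where
  step_left n k := by
    have h : ((n : ℂ) + k + 2) ^ 4 - w ≠ 0 := by
      convert hw (n + k + 1) using 2
      push_cast
      ring
    have e : ((k : ℂ) + 1 + (n + 1 : ℕ)) ^ 4 - w = ((n : ℂ) + k + 2) ^ 4 - w := by
      push_cast
      ring
    unfold zetaKernel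
    rw [Finset.prod_range_succ _ (n + 1), e, mul_inv_rev, mul_inv_cancel_left₀ h]
  step_right n k := by
    unfold zetaKernel
    rw [Finset.prod_range_succ' _ (n + 1), mul_inv_rev, Nat.cast_zero, add_zero,
      mul_inv_cancel_left₀ (hw k)]
    congr 1
    refine Finset.prod_congr rfl fun j _ => ?_
    push_cast
    ring
  isBigO_zero := by
    refine IsBigO.of_bound 2 ?_
    have h := (tendsto_pow_atTop (α := ℝ) (n := 4) (by norm_num)).comp
      (tendsto_natCast_atTop_atTop.comp (tendsto_add_atTop_nat 1))
    filter_upwards [h.eventually_ge_atTop (2 * ‖w‖ + 1)] with k hk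
    simp only [Function.comp_apply, Nat.cast_add, Nat.cast_one] at hk
    have hD := norm_sub_norm_le (((k : ℂ) + 1) ^ 4) w
    rw [norm_pow, ← Nat.cast_add_one, Complex.norm_natCast, Nat.cast_add_one] at hD
    have hw0 := norm_nonneg w
    simp only [zetaKernel, zero_add, Finset.prod_range_one, Nat.cast_zero, add_zero]
    rw [← Nat.cast_add_one, norm_inv, Real.norm_of_nonneg (by positivity), mul_one_div,
      inv_eq_one_div, div_le_div_iff₀ (by linarith) (by positivity)]
    linarith

theorem one_sub_div_pow_four (w : ℂ) (k : ℕ) :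
    1 - w / ((k : ℂ) + 1) ^ 4 = (((k : ℂ) + 1) ^ 4 - w) / ((k : ℂ) + 1) ^ 4 := by
  have : (k : ℂ) + 1 ≠ 0 := Nat.cast_add_one_ne_zero k
  field_simp

theorem wzF_zetaKernel_zero (z : ℂ) (k : ℕ) :
    wzF (z ^ 4) (zetaKernel (z ^ 4)) 0 k = zetaTerm z (k + 1) := by
  have h : (k : ℂ) + 1 ≠ 0 := Nat.cast_add_one_ne_zero k
  simp only [wzF, wzCoeff, zetaKernel, zetaTerm, zero_add, Finset.prod_range_one, Nat.cast_zero,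
    add_zero, Finset.prod_range_zero, pow_zero, Nat.centralBinom_zero, Nat.cast_one, Nat.cast_add,
    one_sub_div_pow_four]
  rw [mul_div_assoc' (((k : ℂ) + 1) ^ 3), one_div_div,
    div_eq_mul_inv _ (((k : ℂ) + 1) ^ 3 * (((k : ℂ) + 1) ^ 4 - z ^ 4)), mul_inv]
  field_simp

theorem wzG_zetaKernel_zero (z : ℂ) (n : ℕ) :
    wzG (z ^ 4) (zetaKernel (z ^ 4)) n 0 = 5 / 2 * aperyTerm z (n + 1) := by
  have h : (n : ℂ) + 1 ≠ 0 := Nat.cast_add_one_ne_zero n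
  have h2 := two_mul_natCast_add_one_ne_zero n
  have h3 := centralBinom_cast_ne_zero n
  have hprod : ∏ j ∈ Finset.Ico 1 (n + 1),
      (1 + 4 * z ^ 4 / (j : ℂ) ^ 4) / (1 - z ^ 4 / (j : ℂ) ^ 4) =
      (∏ m ∈ Finset.range n, (((m : ℂ) + 1) ^ 4 + 4 * z ^ 4)) *
        (∏ m ∈ Finset.range n, (((m : ℂ) + 1) ^ 4 - z ^ 4))⁻¹ := by
    rw [Finset.prod_Ico_eq_prod_range, add_tsub_cancel_right, ← div_eq_mul_inv,
      ← Finset.prod_div_distrib]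
    refine Finset.prod_congr rfl fun m _ => ?_
    have h : (m : ℂ) + 1 ≠ 0 := Nat.cast_add_one_ne_zero m
    rw [add_comm 1 m, Nat.cast_add_one, one_sub_div_pow_four, div_div_eq_mul_div]
    congr 1
    field_simp
  have hker : zetaKernel (z ^ 4) n 0 =
      (∏ m ∈ Finset.range n, (((m : ℂ) + 1) ^ 4 - z ^ 4))⁻¹ * (((n : ℂ) + 1) ^ 4 - z ^ 4)⁻¹ := by
    simp only [zetaKernel, Nat.cast_zero, zero_add, ← mul_inv]
    rw [← Finset.prod_range_succ]
    simp only [add_comm]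
  unfold wzG aperyTerm wzCoeff
  rw [hprod, hker, ← Nat.centralBinom_eq_two_mul_choose, centralBinom_succ_cast, Nat.cast_add_one,
    one_sub_div_pow_four, one_div_div, div_eq_mul_inv _ (((n : ℂ) + 1) ^ 4 - z ^ 4), Nat.cast_zero]
  generalize (∏ m ∈ Finset.range n, (((m : ℂ) + 1) ^ 4 - z ^ 4))⁻¹ = A
  generalize (∏ m ∈ Finset.range n, (((m : ℂ) + 1) ^ 4 + 4 * z ^ 4)) = B
  generalize (((n : ℂ) + 1) ^ 4 - z ^ 4)⁻¹ = C
  field_simp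
  ring

theorem theoremA : TheoremA := by
  intro z hz
  have hw : ∀ k : ℕ, ((k : ℂ) + 1) ^ 4 - z ^ 4 ≠ 0 := fun k => by
    have := hz (k + 1) (Nat.le_add_left 1 k)
    rw [Nat.cast_add_one] at this
    exact sub_ne_zero.2 this.symm
  have hP := isWZKernel_zetaKernel hw
  have hG := hP.hasSum_wzG
  simp_rw [wzF_zetaKernel_zero, wzG_zetaKernel_zero] at hG
  have hs := (summable_mul_left_iff (by norm_num : (5 / 2 : ℂ) ≠ 0)).1 hG.summable
  refine ⟨(hP.summable_wzF 0).congr (wzF_zetaKernel_zero z), hs, ?_⟩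
  rw [← hs.tsum_mul_left, hG.tsum_eq]

/-! ### Residues at the poles -/

/-- The factor `j ^ 4 - (M + 1) ^ 4`, replaced by `1` where it vanishes. -/
noncomputable def residueFactor (M j : ℕ) : ℂ :=
  if j = M + 1 then 1 else (j : ℂ) ^ 4 - ((M : ℂ) + 1) ^ 4

/-- The residue of the kernel `zetaKernel` at `w = (M + 1) ^ 4`, up to sign. -/
noncomputable def residueKernel (M n k : ℕ) : ℂ :=
  if k ≤ M ∧ M ≤ n + k then (∏ j ∈ Finset.range (n + 1), residueFactor M (k + 1 + j))⁻¹ else 0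

theorem natCast_pow_four_sub_ne_zero {a b : ℕ} (h : a ≠ b) :
    (a : ℂ) ^ 4 - (b : ℂ) ^ 4 ≠ 0 := by
  rw [sub_ne_zero]
  exact_mod_cast fun e => h (Nat.pow_left_injective (by norm_num : 4 ≠ 0) e)

theorem residueFactor_of_ne {M j : ℕ} (h : j ≠ M + 1) :
    residueFactor M j = (j : ℂ) ^ 4 - ((M : ℂ) + 1) ^ 4 := if_neg h

theorem residueFactor_ne_zero (M j : ℕ) : residueFactor M j ≠ 0 := by
  unfold residueFactor
  split_ifs with h
  · exact one_ne_zero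
  · exact_mod_cast natCast_pow_four_sub_ne_zero h

theorem isWZKernel_residueKernel (M : ℕ) :
    IsWZKernel (((M : ℂ) + 1) ^ 4) (residueKernel M) where
  step_left n k := by
    have e : ((n : ℂ) + k + 2) = ((k + 1 + (n + 1) : ℕ) : ℂ) := by push_cast; ring
    unfold residueKernel
    by_cases h : k ≤ M ∧ M ≤ n + k
    · have hne : k + 1 + (n + 1) ≠ M + 1 := by omega
      rw [if_pos h, if_pos (by omega), Finset.prod_range_succ _ (n + 1), e,
        ← residueFactor_of_ne hne, mul_inv_rev, mul_inv_cancel_left₀ (residueFactor_ne_zero M _)]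
    · rw [if_neg h]
      by_cases h' : k ≤ M ∧ M ≤ n + 1 + k
      -- Here the pole enters the product with the new factor, and that factor vanishes at `w = (M +
      -- 1) ^ 4`.
      · have : M = n + 1 + k := by omega
        rw [this]
        push_cast
        ring
      · rw [if_neg h', mul_zero]
  step_right n k := by
    unfold residueKernel
    by_cases h : k + 1 ≤ M ∧ M ≤ n + (k + 1)
    · have hne : k + 1 + 0 ≠ M + 1 := by omega
      have e : ((k : ℂ) + 1) ^ 4 - ((M : ℂ) + 1) ^ 4 = residueFactor M (k + 1 + 0) := by
        rw [residueFactor_of_ne hne]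
        push_cast
        ring
      rw [if_pos h, if_pos (by omega), Finset.prod_range_succ' _ (n + 1), e, mul_inv_rev,
        mul_inv_cancel_left₀ (residueFactor_ne_zero M _)]
      congr 1
      refine Finset.prod_congr rfl fun j _ => ?_
      congr 1
      ring
    · rw [if_neg h]
      by_cases h' : k ≤ M ∧ M ≤ n + 1 + k
      -- The pole sits at the left end of the product and is cancelled by the factor removed there.
      · have : M = k := by omega
        rw [this, sub_self, zero_mul]
      · rw [if_neg h', mul_zero]
  isBigO_zero := by
    refine IsBigO.of_bound 0 ?_
    filter_upwards [eventually_gt_atTop M] with k hk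
    rw [residueKernel, if_neg (by omega)]
    simp

theorem tsum_wzF_residueKernel (M : ℕ) :
    ∑' k, wzF (((M : ℂ) + 1) ^ 4) (residueKernel M) 0 k = (M : ℂ) + 1 := by
  rw [tsum_eq_single M fun k hk => ?_]
  · simp [wzF, wzCoeff, residueKernel, residueFactor]
  · rw [wzF, residueKernel, if_neg (by omega), mul_zero]

theorem wzG_at_zero (w : ℂ) (P : ℕ → ℕ → ℂ) (n : ℕ) :
    wzG w P n 0 = wzCoeff w n * (5 / 4 * ((n : ℂ) + 1) ^ 2 / (2 * n + 1)) * P n 0 := by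
  have h2 := two_mul_natCast_add_one_ne_zero n
  unfold wzG
  congr 2
  rw [Nat.cast_zero]
  field_simp
  ring

theorem hasSum_wzG_residueKernel (M : ℕ) :
    HasSum (fun k => wzG (((M : ℂ) + 1) ^ 4) (residueKernel M) (k + M) 0) ((M : ℂ) + 1) := by
  have h := (isWZKernel_residueKernel M).hasSum_wzG
  rw [tsum_wzF_residueKernel] at h
  rw [hasSum_nat_add_iff
    (f := fun n => wzG (((M : ℂ) + 1) ^ 4) (residueKernel M) n 0) M, Finset.sum_eq_zero fun i hi => ?_, add_zero]
  · exact h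
  · rw [wzG, residueKernel, if_neg (by have := Finset.mem_range.1 hi; omega), mul_zero]

/-! ### Statement (B), by comparing term ratios -/

theorem pFqTerm_zero {p q : ℕ} (a : Fin p → ℂ) (b : Fin q → ℂ) (x : ℂ) : pFqTerm a b x 0 = 1 := by
  simp [pFqTerm, pochhammerSymbol]

theorem pFqTerm_succ {p q : ℕ} (a : Fin p → ℂ) (b : Fin q → ℂ) (x : ℂ) (k : ℕ) :
    pFqTerm a b x (k + 1) =
      (∏ i, (a i + k)) / (∏ i, (b i + k)) * (x / (k + 1)) * pFqTerm a b x k := by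
  simp only [pFqTerm, pochhammerSymbol, Finset.prod_range_succ _ k, Finset.prod_mul_distrib,
    Nat.factorial_succ, pow_succ]
  push_cast
  rw [mul_div_mul_comm, mul_comm (x ^ k), mul_div_mul_comm]
  ring

theorem pFqTerm_params_succ (N k : ℕ) :
    pFqTerm (upperParams N) (lowerParams N) (-1 / 4) (k + 1) =
      -(((N : ℂ) + k + 1) ^ 2 * (((N : ℂ) + k) ^ 4 + 4 * (N : ℂ) ^ 4)) /
        (2 * ((N : ℂ) + k) * (2 * (N + k) + 1) * (((N : ℂ) + k + 1) ^ 4 - (N : ℂ) ^ 4)) *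
      pFqTerm (upperParams N) (lowerParams N) (-1 / 4) k := by
  have hu : ∏ i, (upperParams N i + k) =
      ((N : ℂ) + k + 1) ^ 2 * (((N : ℂ) + k) ^ 4 + 4 * (N : ℂ) ^ 4) := by
    simp only [upperParams, Fin.prod_univ_succ, Matrix.cons_val_zero, Matrix.cons_val_succ,
      Finset.univ_eq_empty, Finset.prod_empty]
    -- Sophie Germain factorization of X⁴ + 4N⁴ at X = N + k, split into linear factors over ℂ.
    have : (2 * (N : ℂ) + Complex.I * N + k) * (2 * (N : ℂ) - Complex.I * N + k) *
        ((Complex.I * N + k) * (-(Complex.I * N) + k)) =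
        ((N : ℂ) + k) ^ 4 + 4 * (N : ℂ) ^ 4 := by
      linear_combination (-(N : ℂ) ^ 2 * ((2 * (N : ℂ) + k) ^ 2 + (k : ℂ) ^ 2) +
        (N : ℂ) ^ 4 * (Complex.I ^ 2 - 1)) * Complex.I_sq
    linear_combination ((N : ℂ) + k + 1) ^ 2 * this
  -- The factor `k + 1` comes from the factorial and completes the factorization of (N + k + 1)⁴ -
  -- N⁴; the 4 comes from the argument -1/4.
  have hl : (∏ i, (lowerParams N i + k)) * ((k : ℂ) + 1) * 4 =
      2 * ((N : ℂ) + k) * (2 * (N + k) + 1) * (((N : ℂ) + k + 1) ^ 4 - (N : ℂ) ^ 4) := by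
    simp only [lowerParams, Fin.prod_univ_succ, Matrix.cons_val_zero, Matrix.cons_val_succ,
      Finset.univ_eq_empty, Finset.prod_empty]
    have : (2 * (N : ℂ) + 1 + k) * ((N : ℂ) + 1 + Complex.I * N + k) *
        ((N : ℂ) + 1 - Complex.I * N + k) * (k + 1) = ((N : ℂ) + k + 1) ^ 4 - (N : ℂ) ^ 4 := by
      linear_combination (-(N : ℂ) ^ 2 * (2 * (N : ℂ) + 1 + k) * (k + 1)) * Complex.I_sq
    linear_combination 2 * ((N : ℂ) + k) * (2 * (N + k) + 1) * this
  rw [pFqTerm_succ, hu, ← hl]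
  congr 1
  rw [div_mul_div_comm, ← mul_div_mul_right _ _ (by norm_num : (4 : ℂ) ≠ 0)]
  congr 1
  ring

theorem wzG_residueKernel_succ (M k : ℕ) :
    wzG (((M : ℂ) + 1) ^ 4) (residueKernel M) (k + M + 1) 0 =
      -((((M + 1 : ℕ) : ℂ) + k + 1) ^ 2 *
          ((((M + 1 : ℕ) : ℂ) + k) ^ 4 + 4 * ((M + 1 : ℕ) : ℂ) ^ 4)) /
        (2 * (((M + 1 : ℕ) : ℂ) + k) * (2 * (((M + 1 : ℕ) : ℂ) + k) + 1) *
          ((((M + 1 : ℕ) : ℂ) + k + 1) ^ 4 - ((M + 1 : ℕ) : ℂ) ^ 4)) *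
      wzG (((M : ℂ) + 1) ^ 4) (residueKernel M) (k + M) 0 := by
  have hD : (((k + M : ℕ) : ℂ) + 2) ^ 4 - ((M : ℂ) + 1) ^ 4 ≠ 0 := by
    exact_mod_cast natCast_pow_four_sub_ne_zero (a := k + M + 2) (b := M + 1) (by omega)
  have h1 : ((k + M : ℕ) : ℂ) + 1 ≠ 0 := Nat.cast_add_one_ne_zero _
  have h2 := two_mul_natCast_add_one_ne_zero (k + M)
  have h3 := two_mul_natCast_add_one_ne_zero (k + M + 1)
  have e : ((M + 1 : ℕ) : ℂ) + k = ((k + M : ℕ) : ℂ) + 1 := by push_cast; ring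
  rw [wzG_at_zero, wzG_at_zero, (isWZKernel_residueKernel M).step_left (k + M) 0, wzCoeff_succ, e]
  simp only [Nat.cast_add_one, Nat.cast_zero, add_zero] at h3 ⊢
  generalize ((k + M : ℕ) : ℂ) = K at *
  rw [show K + 1 + 1 = K + 2 by ring] at *
  generalize hd : (K + 2) ^ 4 - ((M : ℂ) + 1) ^ 4 = D at *
  field_simp

theorem wzG_residueKernel_add (M k : ℕ) :
    wzG (((M : ℂ) + 1) ^ 4) (residueKernel M) (k + M) 0 =
      wzG (((M : ℂ) + 1) ^ 4) (residueKernel M) M 0 *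
        pFqTerm (upperParams (M + 1)) (lowerParams (M + 1)) (-1 / 4) k := by
  induction k with
  | zero => rw [pFqTerm_zero, zero_add, mul_one]
  | succ k ih =>
    rw [show k + 1 + M = k + M + 1 by ring, wzG_residueKernel_succ, ih,
      pFqTerm_params_succ]
    ring

theorem residueKernel_self_zero (M : ℕ) :
    residueKernel M M 0 =
      (∏ m ∈ Finset.range M, (((m : ℂ) + 1) ^ 4 - ((M : ℂ) + 1) ^ 4))⁻¹ := by
  rw [residueKernel, if_pos (by omega), Finset.prod_range_succ]
  congr 1
  rw [show residueFactor M (0 + 1 + M) = 1 from if_pos (by omega), mul_one]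
  refine Finset.prod_congr rfl fun m hm => ?_
  have := Finset.mem_range.1 hm
  rw [residueFactor_of_ne (by omega)]
  push_cast
  ring

/-- The product form gives two things at once: the first nonzero term of ∑ G(n,0) is invertible, and
dividing the total `M + 1` by it yields the closed form in (B). -/
theorem wzG_residueKernel_self_mul (M : ℕ) :
    wzG (((M : ℂ) + 1) ^ 4) (residueKernel M) M 0 *
      (2 / 5 * ((2 * (M + 1)).choose (M + 1) : ℂ) * ∏ j ∈ Finset.Ico 1 (M + 1),
        (((M + 1 : ℕ) : ℂ) ^ 4 - (j : ℂ) ^ 4) / (4 * ((M + 1 : ℕ) : ℂ) ^ 4 + (j : ℂ) ^ 4)) =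
      (M : ℂ) + 1 := by
  have h1 : (M : ℂ) + 1 ≠ 0 := Nat.cast_add_one_ne_zero M
  have h2 := two_mul_natCast_add_one_ne_zero M
  have h3 := centralBinom_cast_ne_zero M
  have hA : ∏ m ∈ Finset.range M, (((m : ℂ) + 1) ^ 4 - ((M : ℂ) + 1) ^ 4) ≠ 0 :=
    Finset.prod_ne_zero_iff.2 fun m hm => by
      exact_mod_cast natCast_pow_four_sub_ne_zero (a := m + 1) (b := M + 1)
        (by have := Finset.mem_range.1 hm; omega)
  have hB : ∏ m ∈ Finset.range M, (((m : ℂ) + 1) ^ 4 + 4 * ((M : ℂ) + 1) ^ 4) ≠ 0 :=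
    Finset.prod_ne_zero_iff.2 fun m _ => by
      exact_mod_cast (by positivity : (m + 1) ^ 4 + 4 * (M + 1) ^ 4 ≠ 0)
  have hprod : ∏ j ∈ Finset.Ico 1 (M + 1),
      (((M + 1 : ℕ) : ℂ) ^ 4 - (j : ℂ) ^ 4) / (4 * ((M + 1 : ℕ) : ℂ) ^ 4 + (j : ℂ) ^ 4) =
      (-1) ^ M * ((∏ m ∈ Finset.range M, (((m : ℂ) + 1) ^ 4 - ((M : ℂ) + 1) ^ 4)) /
        ∏ m ∈ Finset.range M, (((m : ℂ) + 1) ^ 4 + 4 * ((M : ℂ) + 1) ^ 4)) := by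
    rw [Finset.prod_Ico_eq_prod_range, add_tsub_cancel_right, ← Finset.prod_div_distrib]
    have : (-1 : ℂ) ^ M = ∏ m ∈ Finset.range M, (-1 : ℂ) := by simp
    rw [this, ← Finset.prod_mul_distrib]
    refine Finset.prod_congr rfl fun m _ => ?_
    push_cast
    ring
  have hsq : ((-1 : ℂ) ^ M) * (-1) ^ M = 1 := by rw [← mul_pow]; simp
  rw [wzG_at_zero, hprod, residueKernel_self_zero, ← Nat.centralBinom_eq_two_mul_choose,
    centralBinom_succ_cast, wzCoeff]
  generalize (∏ m ∈ Finset.range M, (((m : ℂ) + 1) ^ 4 - ((M : ℂ) + 1) ^ 4)) = A at *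
  generalize (∏ m ∈ Finset.range M, (((m : ℂ) + 1) ^ 4 + 4 * ((M : ℂ) + 1) ^ 4)) = B at *
  generalize (-1 : ℂ) ^ M = s at *
  generalize 2 * (M : ℂ) + 1 = d at *
  field_simp
  linear_combination 4 * hsq

/-- The evaluation of the hypergeometric series at `-1/4`, with convergence. -/
theorem hasSum_pFqTerm_params {n : ℕ} (hn : 0 < n) :
    HasSum (pFqTerm (upperParams n) (lowerParams n) (-1 / 4))
      (2 / 5 * ((2 * n).choose n : ℂ) * ∏ j ∈ Finset.Ico 1 n,
        ((n : ℂ) ^ 4 - (j : ℂ) ^ 4) / (4 * (n : ℂ) ^ 4 + (j : ℂ) ^ 4)) := by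
  obtain ⟨M, rfl⟩ : ∃ M, n = M + 1 := ⟨n - 1, by omega⟩
  have hval := wzG_residueKernel_self_mul M
  have h := hasSum_wzG_residueKernel M
  simp_rw [wzG_residueKernel_add] at h
  have h0 : wzG (((M : ℂ) + 1) ^ 4) (residueKernel M) M 0 ≠ 0 := fun h0 => by
    rw [h0, zero_mul] at hval
    exact Nat.cast_add_one_ne_zero M hval.symm
  refine (hasSum_mul_left_iff h0).1 ?_
  rwa [hval]

theorem corollary2 :
    TheoremA ↔
      ∀ n : ℕ, 0 < n →
        Summable (pFqTerm (upperParams n) (lowerParams n) (-1 / 4)) ∧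
        pFq (upperParams n) (lowerParams n) (-1 / 4) =
          2 / 5 * ((2 * n).choose n : ℂ) *
            ∏ j ∈ Finset.Ico 1 n,
              ((n : ℂ) ^ 4 - (j : ℂ) ^ 4) / (4 * (n : ℂ) ^ 4 + (j : ℂ) ^ 4) :=
  iff_of_true theoremA fun _ hn =>
    ⟨(hasSum_pFqTerm_params hn).summable, (hasSum_pFqTerm_params hn).tsum_eq⟩
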